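/- Let $R$ be a commutative ring and let $\mathcal P=(\mathcal P(n))_{n\ge 0}$ be a symmetric operad in $R$-modules, with unit $1_{\mathcal P}\in\mathcal P(1)$ and compositions $\mu(\nu_1,\dots,\nu_k)$. For an $R$-module $V$ let $\mathsf S(\mathcal P,V)=\bigoplus_{n\ge 0}(\mathcal P(n)\otimes_R V^{\otimes n})_{\Sigma(n)}$ be the free $\mathcal P$-algebra on $V$, where $(\mu;v_1,\dots,v_n)$ denotes the class of $\mu\otimes v_1\otimes\cdots\otimes v_n$; its operations are determined by $$\mu\big((\nu_1;v_{1,1},\dots,v_{1,n_1}),\dots,(\nu_k;v_{k,1},\dots,v_{k,n_k})\big)=(\mu(\nu_1,\dots,\nu_k);v_{1,1},\dots,v_{k,n_k}),$$ and $v\in V$ is identified with $(1_{\mathcal P};v)$. Let $A$ be a $\mathcal P$-algebra. An $A$-module is an $R$-module $M$ with $R$-linear evaluation maps $\mathcal P(n+1)\otimes A^{\otimes n}\otimes M\to M$, $(\mu,a_1,\dots,a_n,x)\mapsto\mu(a_1,\dots,a_n,x)$, for $n\ge 0$, which are equivariant, associative and unital; $\mu(a_1,\dots,a_{k-1},x,a_{k+1},\dots,a_n)$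 for $x$ in another place is defined through the action of the symmetric group on $\mathcal P(n)$. Let $\mathsf{MOD}_A$ be the category of $A$-modules and $R$-linear maps preserving the evaluations. Let $\mathsf{ALG}_A$ be the category of $A$-algebras, that is, of $\mathcal P$-algebras $B$ with a morphism of $\mathcal P$-algebras $u:A\to B$. Let $\mathsf U_A:\mathsf{ALG}_A\to\mathsf{MOD}_A$ be the forgetful functor, where $B$ is an $A$-module through $\mu(a_1,\dots,a_n,b)=\mu(u(a_1),\dots,u(a_n),b)$. For an $A$-module $M$ let $\mathsf{Free}_A(M)$ be the quotient of the $\mathcal P$-algebra $\mathsf S(\mathcal P,A\times M)$ by the ideal generated by the relations $$(\mu;(a_1,0),\dots,(a_{k-1},0),(a_k,x),(a_{k+1},0),\dots,(a_n,0))=\big(\mu(a_1,\dots,a_n),\ \mu(a_1,\dots,a_{k-1},x,a_{k+1},\dots,a_n)\big)$$ for all $n\ge 1$, $1\le k\le n$, $\mu\in\mathcal P(n)$, $a_1,\dots,a_n\in A$, $x\in M$, together with their nullary analogue $(\mu;\,)=(\mu(),0)$ for all $\mu\in\mathcal P(0)$, where $\mu()\in A$ is the value of $\mu$ in $A$. Then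 $u_M:A\to\mathsf{Free}_A(M)$, $u_M(a)=(a,0)$, makes $\mathsf{Free}_A(M)$ an $A$-algebra, and $\mathsf{Free}_A$ extends to a functor $\mathsf{MOD}_A\to\mathsf{ALG}_A$, with $\mathsf{Free}_A(f)(a,x)=(a,f(x))$ on generators, which is left adjoint to $\mathsf U_A$; the unit of the adjunction is $M\to\mathsf U_A\mathsf{Free}_A(M)$, $x\mapsto(0,x)$. -/

import Mathlib

open CategoryTheory TensorProduct

universe u

namespace OperadicAlgebra

/-! ### Multilinear maps: extension from generators and descent to quotients -/

section Multilinear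

variable {R : Type*} [CommRing R] {ι : Type*} [Fintype ι]
  {E Q N : Type*} [AddCommGroup E] [Module R E] [AddCommGroup Q] [Module R Q]
  [AddCommGroup N] [Module R N]

open Classical in
/-- The multilinear map on a free module with prescribed values on tuples of basis elements. -/
noncomputable def extendMul {G : Type*} (val : (ι → G) → N) :
    MultilinearMap R (fun _ : ι => G →₀ R) N :=
  (Finsupp.linearCombination R val ∘ₗ
    (PiTensorProduct.ofFinsuppEquiv' (R := R) (ι := ι)
      (κ := fun _ => G)).toLinearMap).compMultilinearMap (PiTensorProduct.tprod R)

theorem extendMul_single {G : Type*} (val : (ι → G) → N) (g : ι → G) :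
    extendMul (R := R) val (fun i => Finsupp.single (g i) 1) = val g := by
  classical
  simp [extendMul]

theorem eq_of_vanish (q : E →ₗ[R] Q) (f : MultilinearMap R (fun _ : ι => E) N)
    (hf : ∀ (i : ι) (e : ι → E), q (e i) = 0 → f e = 0)
    (e e' : ι → E) (h : ∀ i, q (e i) = q (e' i)) : f e = f e' := by
  classical
  have key : ∀ s : Finset ι, f (s.piecewise e e') = f e' := by
    intro s
    induction s using Finset.induction_on with
    | empty => simp
    | insert i s hi ih =>
      rw [← ih, Finset.piecewise_insert]
      have h1 : s.piecewise e e' = Function.update (s.piecewise e e') i (e' i) := by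
        rw [eq_comm, Function.update_eq_self_iff]
        simp [hi]
      conv_rhs => rw [h1]
      rw [← sub_eq_zero, ← MultilinearMap.map_update_sub]
      apply hf i
      simp [h i]
  simpa using key Finset.univ

/-- Descent of a multilinear map along a surjective linear map, if it vanishes as soon as one
argument lies in the kernel. -/
noncomputable def descend (q : E →ₗ[R] Q) (hq : Function.Surjective q)
    (f : MultilinearMap R (fun _ : ι => E) N)
    (hf : ∀ (i : ι) (e : ι → E), q (e i) = 0 → f e = 0) :
    MultilinearMap R (fun _ : ι => Q) N where
  toFun s := f (fun i => Function.surjInv hq (s i))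
  map_update_add' s i x y := by
    classical
    rw [eq_of_vanish q f hf (fun j => Function.surjInv hq (Function.update s i (x + y) j))
      (Function.update (fun j => Function.surjInv hq (s j)) i
        (Function.surjInv hq x + Function.surjInv hq y)),
      eq_of_vanish q f hf (fun j => Function.surjInv hq (Function.update s i x j))
      (Function.update (fun j => Function.surjInv hq (s j)) i (Function.surjInv hq x)),
      eq_of_vanish q f hf (fun j => Function.surjInv hq (Function.update s i y j))
      (Function.update (fun j => Function.surjInv hq (s j)) i (Function.surjInv hq y)),
      MultilinearMap.map_update_add]
    all_goals
      intro j
      by_cases hj : j = i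
      · subst hj; simp [Function.surjInv_eq]
      · simp [hj, Function.surjInv_eq]
  map_update_smul' s i c x := by
    classical
    rw [eq_of_vanish q f hf (fun j => Function.surjInv hq (Function.update s i (c • x) j))
      (Function.update (fun j => Function.surjInv hq (s j)) i (c • Function.surjInv hq x)),
      eq_of_vanish q f hf (fun j => Function.surjInv hq (Function.update s i x j))
      (Function.update (fun j => Function.surjInv hq (s j)) i (Function.surjInv hq x)),
      MultilinearMap.map_update_smul]
    all_goals
      intro j
      by_cases hj : j = i
      · subst hj; simp [Function.surjInv_eq]
      · simp [hj, Function.surjInv_eq]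

theorem descend_apply (q : E →ₗ[R] Q) (hq : Function.Surjective q)
    (f : MultilinearMap R (fun _ : ι => E) N)
    (hf : ∀ (i : ι) (e : ι → E), q (e i) = 0 → f e = 0) (e : ι → E) :
    descend q hq f hf (fun i => q (e i)) = f e := by
  apply eq_of_vanish q f hf
  intro i
  simp [Function.surjInv_eq]

end Multilinear

/-! ### Operads -/

/-- A sequence of `R`-modules `obj n`, each with an `R`-linear right action
`μ ↦ perm σ μ = μ · σ` of the symmetric group on `n` letters. -/
structure SymmSeq (R : Type u) [CommRing R] where
  obj : ℕ → Type u
  [addCommGroup : ∀ n, AddCommGroup (obj n)]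
  [module : ∀ n, Module R (obj n)]
  perm : ∀ {n : ℕ}, Equiv.Perm (Fin n) → obj n →ₗ[R] obj n
  perm_one : ∀ {n : ℕ} (μ : obj n), perm 1 μ = μ
  perm_mul : ∀ {n : ℕ} (σ τ : Equiv.Perm (Fin n)) (μ : obj n),
    perm (σ * τ) μ = perm τ (perm σ μ)

attribute [instance] SymmSeq.addCommGroup SymmSeq.module

namespace SymmSeq

variable {R : Type u} [CommRing R] (P : SymmSeq R)

/-- Transport along an equality of arities. -/
def castHom {m n : ℕ} (h : m = n) : P.obj m →ₗ[R] P.obj n :=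
  h ▸ LinearMap.id

/-- Relabelling of inputs along a bijection `e` of the sets of inputs: thinking of `μ` as an
operation, `(relabel e μ)(a) = μ(a ∘ e)`. If `e` preserves the order this is the transport along
`m = n`; if `m = n` it is the action of the permutation `e⁻¹`. -/
def relabel {m n : ℕ} (e : Fin m ≃ Fin n) : P.obj m →ₗ[R] P.obj n :=
  have h : m = n := Fin.equiv_iff_eq.mp ⟨e⟩
  P.castHom h ∘ₗ P.perm (e.trans (finCongr h).symm)⁻¹

theorem relabel_perm {n : ℕ} (σ : Equiv.Perm (Fin n)) : P.relabel σ = P.perm σ⁻¹ := rfl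

end SymmSeq

/-- The identification of the inputs of `μ(ν₁, …, νₖ)` with pairs (input `i` of `μ`, input of
`νᵢ`), in lexicographic order. -/
abbrev pairs {k : ℕ} (n : Fin k → ℕ) : (i : Fin k) × Fin (n i) ≃ Fin (∑ i, n i) :=
  finSigmaFinEquiv

/-- Concatenation of `k` tuples of lengths `n₁, …, nₖ`. -/
def flat {k : ℕ} {V : Type*} (n : Fin k → ℕ) (v : ∀ i, Fin (n i) → V) : Fin (∑ i, n i) → V :=
  fun t => v ((pairs n).symm t).1 ((pairs n).symm t).2

theorem flat_pairs {k : ℕ} {V : Type*} (n : Fin k → ℕ) (v : ∀ i, Fin (n i) → V) (i : Fin k)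
    (j : Fin (n i)) : flat n v (pairs n ⟨i, j⟩) = v i j :=
  congrArg (fun p : (i : Fin k) × Fin (n i) => v p.1 p.2) ((pairs n).symm_apply_apply ⟨i, j⟩)

theorem restrict_update {k : ℕ} {V : Type*} (n : Fin k → ℕ) (a : Fin (∑ i, n i) → V)
    (i : Fin k) (j : Fin (n i)) (x : V) (i' : Fin k) :
    (fun j' => Function.update a (pairs n ⟨i, j⟩) x (pairs n ⟨i', j'⟩)) =
      Function.update (fun i' j' => a (pairs n ⟨i', j'⟩)) i
        (Function.update (fun j' => a (pairs n ⟨i, j'⟩)) j x) i' := by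
  funext j'
  by_cases hi : i' = i
  · subst hi
    by_cases hj : j' = j
    · subst hj; simp
    · rw [Function.update_of_ne (by simpa using hj)]
      simp [hj]
  · rw [Function.update_of_ne (by simp [hi])]
    simp [hi]

/-- The multilinear map `a ↦ f(g₁(a₁₁, …), …, gₖ(…, aₖₙ))`. -/
def compose {R V W Z : Type*} [CommRing R] [AddCommGroup V] [Module R V] [AddCommGroup W]
    [Module R W] [AddCommGroup Z] [Module R Z] {k : ℕ} (n : Fin k → ℕ)
    (f : MultilinearMap R (fun _ : Fin k => W) Z)
    (g : ∀ i, MultilinearMap R (fun _ : Fin (n i) => V) W) :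
    MultilinearMap R (fun _ : Fin (∑ i, n i) => V) Z :=
  have h (a : Fin (∑ i, n i) → V) (i : Fin k) (j : Fin (n i)) (x : V) :
      (fun i' => g i' fun j' => Function.update a (pairs n ⟨i, j⟩) x (pairs n ⟨i', j'⟩)) =
        Function.update (fun i' => g i' fun j' => a (pairs n ⟨i', j'⟩)) i
          (g i (Function.update (fun j' => a (pairs n ⟨i, j'⟩)) j x)) := by
    funext i'
    rw [restrict_update]
    by_cases hi : i' = i
    · subst hi; simp
    · simp [hi]
  MultilinearMap.mk' (fun a => f fun i => g i fun j => a (pairs n ⟨i, j⟩))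
    (by
      intro a t x y
      obtain ⟨⟨i, j⟩, rfl⟩ := (pairs n).surjective t
      simp only [h, MultilinearMap.map_update_add])
    (by
      intro a t c x
      obtain ⟨⟨i, j⟩, rfl⟩ := (pairs n).surjective t
      simp only [h, MultilinearMap.map_update_smul])

theorem compose_apply {R V W Z : Type*} [CommRing R] [AddCommGroup V] [Module R V]
    [AddCommGroup W] [Module R W] [AddCommGroup Z] [Module R Z] {k : ℕ} (n : Fin k → ℕ)
    (f : MultilinearMap R (fun _ : Fin k => W) Z)
    (g : ∀ i, MultilinearMap R (fun _ : Fin (n i) => V) W) (a : Fin (∑ i, n i) → V) :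
    compose n f g a = f fun i => g i fun j => a (pairs n ⟨i, j⟩) := rfl

/-- The permutation `σ₁ ⊕ ⋯ ⊕ σₖ` of the inputs of a composite. -/
def blockSum {k : ℕ} (n : Fin k → ℕ) (σ : ∀ i, Equiv.Perm (Fin (n i))) :
    Equiv.Perm (Fin (∑ i, n i)) :=
  (pairs n).permCongr (Equiv.sigmaCongrRight σ)

/-- The bijection of inputs of composites that permutes the blocks of inputs:
`(i, j) ↦ (σ⁻¹ i, j)`. -/
def blockPerm {k : ℕ} (n : Fin k → ℕ) (σ : Equiv.Perm (Fin k)) :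
    Fin (∑ i, n (σ⁻¹ i)) ≃ Fin (∑ i, n i) :=
  ((pairs fun i => n (σ⁻¹ i)).symm.trans
    (Equiv.sigmaCongrLeft (β := fun i => Fin (n i)) σ⁻¹)).trans (pairs n)

/-- The order preserving bijection `j ↦ (j, 0)`. -/
def unitRight (k : ℕ) : Fin k ≃ Fin (∑ _i : Fin k, 1) :=
  (Equiv.sigmaUnique (Fin k) fun _ => Fin 1).symm.trans (pairs fun _ => 1)

/-- The order preserving bijection `j ↦ (0, j)`. -/
def unitLeft (n : Fin 1 → ℕ) : Fin (n 0) ≃ Fin (∑ i, n i) :=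
  (Equiv.uniqueSigma fun i => Fin (n i)).symm.trans (pairs n)

/-- The order preserving bijection `(i, (j, l)) ↦ ((i, j), l)`. -/
def assocEquiv {k : ℕ} (n : Fin k → ℕ) (l : Fin (∑ i, n i) → ℕ) :
    Fin (∑ i, ∑ j, l (pairs n ⟨i, j⟩)) ≃ Fin (∑ t, l t) :=
  (pairs fun i => ∑ j, l (pairs n ⟨i, j⟩)).symm.trans <|
    (Equiv.sigmaCongrRight fun i => (pairs fun j => l (pairs n ⟨i, j⟩)).symm).trans <|
      (Equiv.sigmaAssoc fun i j => Fin (l (pairs n ⟨i, j⟩))).symm.trans <|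
        (Equiv.sigmaCongrLeft (β := fun t => Fin (l t)) (pairs n)).trans (pairs l)

/-- A symmetric operad in `R`-modules, with its complete composition
`comp n μ ν = μ(ν₁, …, νₖ)`, where `νᵢ ∈ P(nᵢ)`. (The partial compositions are
`μ ∘ᵢ ν = μ(1, …, ν, …, 1)`.) -/
structure Operad (R : Type u) [CommRing R] extends SymmSeq R where
  one : obj 1
  comp : ∀ {k : ℕ} (n : Fin k → ℕ),
    obj k →ₗ[R] MultilinearMap R (fun i => obj (n i)) (obj (∑ i, n i))
  comp_one : ∀ {k : ℕ} (μ : obj k),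
    comp (fun _ => 1) μ (fun _ => one) = toSymmSeq.relabel (unitRight k) μ
  one_comp : ∀ (n : Fin 1 → ℕ) (ν : ∀ i, obj (n i)),
    comp n one ν = toSymmSeq.relabel (unitLeft n) (ν 0)
  comp_perm_right : ∀ {k : ℕ} (n : Fin k → ℕ) (μ : obj k) (ν : ∀ i, obj (n i))
    (σ : ∀ i, Equiv.Perm (Fin (n i))),
    comp n μ (fun i => perm (σ i) (ν i)) = perm (blockSum n σ) (comp n μ ν)
  comp_perm_left : ∀ {k : ℕ} (n : Fin k → ℕ) (μ : obj k) (ν : ∀ i, obj (n i))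
    (σ : Equiv.Perm (Fin k)),
    comp n (perm σ μ) ν =
      toSymmSeq.relabel (blockPerm n σ) (comp (fun i => n (σ⁻¹ i)) μ fun i => ν (σ⁻¹ i))
  comp_assoc : ∀ {k : ℕ} (n : Fin k → ℕ) (l : Fin (∑ i, n i) → ℕ) (μ : obj k)
    (ν : ∀ i, obj (n i)) (ξ : ∀ t, obj (l t)),
    comp l (comp n μ ν) ξ =
      toSymmSeq.relabel (assocEquiv n l)
        (comp (fun i => ∑ j, l (pairs n ⟨i, j⟩)) μ fun i =>
          comp (fun j => l (pairs n ⟨i, j⟩)) (ν i) fun j => ξ (pairs n ⟨i, j⟩))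

variable {R : Type u} [CommRing R]

/-! ### Algebras over an operad -/

/-- An algebra over the operad `P`: an `R`-module with operations `op μ a = μ(a₁, …, aₙ)`, linear
in `μ` and in each `aᵢ`. -/
structure PAlg (P : Operad R) where
  carrier : Type u
  [addCommGroup : AddCommGroup carrier]
  [module : Module R carrier]
  op : ∀ {n : ℕ}, P.obj n →ₗ[R] MultilinearMap R (fun _ : Fin n => carrier) carrier
  op_perm : ∀ {n : ℕ} (σ : Equiv.Perm (Fin n)) (μ : P.obj n) (a : Fin n → carrier),
    op (P.perm σ μ) a = op μ (fun i => a (σ⁻¹ i))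
  op_one : ∀ a : Fin 1 → carrier, op P.one a = a 0
  op_comp : ∀ {k : ℕ} (n : Fin k → ℕ) (μ : P.obj k) (ν : ∀ i, P.obj (n i))
    (a : Fin (∑ i, n i) → carrier),
    op (P.comp n μ ν) a = op μ (fun i => op (ν i) fun j => a (pairs n ⟨i, j⟩))

attribute [instance] PAlg.addCommGroup PAlg.module

instance (P : Operad R) : CoeSort (PAlg P) (Type u) := ⟨PAlg.carrier⟩

namespace PAlg

variable {P : Operad R}

/-- Morphisms of algebras over an operad. -/
@[ext]
structure Hom (A B : PAlg P) where
  hom : A →ₗ[R] B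
  map_op : ∀ {n : ℕ} (μ : P.obj n) (a : Fin n → A), hom (A.op μ a) = B.op μ (fun i => hom (a i))

/-- The category of `P`-algebras. -/
instance : Category (PAlg P) where
  Hom := Hom
  id A := ⟨LinearMap.id, fun _ _ => rfl⟩
  comp f g := ⟨g.hom ∘ₗ f.hom, fun μ a => by simp [f.map_op, g.map_op]⟩

end PAlg

/-! ### Modules over an algebra over an operad -/

/-- The cycle with `last ↦ k` that is increasing on the other elements. -/
def toLast {n : ℕ} (k : Fin (n + 1)) : Equiv.Perm (Fin (n + 1)) :=
  (finSuccEquiv' (Fin.last n)).trans (finSuccEquiv' k).symm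

/-- The extension of a permutation of the first `n` letters by the fixed letter `last`. -/
def fixLast {n : ℕ} (σ : Equiv.Perm (Fin n)) : Equiv.Perm (Fin (n + 1)) :=
  (finSuccEquiv' (Fin.last n)).trans
    ((Equiv.optionCongr σ).trans (finSuccEquiv' (Fin.last n)).symm)

/-- Given evaluation maps `ev μ (a₁, …, aₙ) x = μ(a₁, …, aₙ, x)`, the evaluation
`μ(a₁, …, x, …, aₙ)` with `x` in place of `aₖ`, that is `(μ · c)(a₁, …, âₖ, …, aₙ, x)` for the
cycle `c` that moves the last place to the `k`-th. The value `aₖ` is not used. -/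
def evSlot {P : Operad R} {A : PAlg P} {M : Type u} [AddCommGroup M] [Module R M]
    (ev : ∀ {n : ℕ}, P.obj (n + 1) →ₗ[R] MultilinearMap R (fun _ : Fin n => A) (M →ₗ[R] M)) :
    ∀ {n : ℕ}, Fin n → P.obj n → (Fin n → A) → M → M
  | 0, k, _, _, _ => k.elim0
  | _ + 1, k, μ, a, x => ev (P.perm (toLast k) μ) (fun j => a (k.succAbove j)) x

/-- A module over the `P`-algebra `A`: an `R`-module `M` with evaluation maps
`ev μ a x = μ(a₁, …, aₙ, x)`, that is `P(n+1) ⊗ A^{⊗ n} ⊗ M → M`, which are equivariant,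
associative and unital. -/
structure AMod {P : Operad R} (A : PAlg P) where
  carrier : Type u
  [addCommGroup : AddCommGroup carrier]
  [module : Module R carrier]
  ev : ∀ {n : ℕ},
    P.obj (n + 1) →ₗ[R] MultilinearMap R (fun _ : Fin n => A) (carrier →ₗ[R] carrier)
  ev_perm : ∀ {n : ℕ} (σ : Equiv.Perm (Fin n)) (μ : P.obj (n + 1)) (a : Fin n → A) (x : carrier),
    ev (P.perm (fixLast σ) μ) a x = ev μ (fun i => a (σ⁻¹ i)) x
  ev_one : ∀ (a : Fin 0 → A) (x : carrier), ev P.one a x = x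
  ev_comp : ∀ {k : ℕ} (n : Fin k → ℕ) (μ : P.obj k) (ν : ∀ i, P.obj (n i))
    (i : Fin k) (j : Fin (n i)) (a : Fin (∑ i, n i) → A) (x : carrier),
    evSlot ev (pairs n ⟨i, j⟩) (P.comp n μ ν) a x =
      evSlot ev i μ (fun i' => A.op (ν i') fun j' => a (pairs n ⟨i', j'⟩))
        (evSlot ev j (ν i) (fun j' => a (pairs n ⟨i, j'⟩)) x)

attribute [instance] AMod.addCommGroup AMod.module

instance {P : Operad R} (A : PAlg P) : CoeSort (AMod A) (Type u) := ⟨AMod.carrier⟩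

namespace AMod

variable {P : Operad R} {A : PAlg P}

/-- The evaluation `μ(a₁, …, x, …, aₙ)` with `x` in place of `aₖ`. -/
def evAt (M : AMod A) {n : ℕ} (k : Fin n) (μ : P.obj n) (a : Fin n → A) (x : M) : M :=
  evSlot M.ev k μ a x

/-- `A`-linear morphisms. -/
@[ext]
structure Hom (M N : AMod A) where
  hom : M →ₗ[R] N
  map_ev : ∀ {n : ℕ} (μ : P.obj (n + 1)) (a : Fin n → A) (x : M),
    hom (M.ev μ a x) = N.ev μ a (hom x)

/-- The category of `A`-modules. -/
instance : Category (AMod A) where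
  Hom := Hom
  id M := ⟨LinearMap.id, fun _ _ _ => rfl⟩
  comp f g := ⟨g.hom ∘ₗ f.hom, fun μ a x => by simp [f.map_ev, g.map_ev]⟩

end AMod

/-! ### The free algebra `S(P, V)` -/

section FreeAlgebra

variable (P : Operad R) (V : Type u) [AddCommGroup V] [Module R V]

/-- The diagonal action `σ · (μ ⊗ v) = (μ · σ⁻¹) ⊗ (σ v)` of the symmetric group on
`P(n) ⊗ V^{⊗ n}`, where `σ` permutes the tensor factors of `V^{⊗ n}`. -/
noncomputable def diag (n : ℕ) :
    Representation R (Equiv.Perm (Fin n)) (P.obj n ⊗[R] PiTensorProduct R fun _ : Fin n => V) where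
  toFun σ := TensorProduct.map (P.perm σ⁻¹) (PiTensorProduct.reindex R (fun _ => V) σ).toLinearMap
  map_one' := by
    ext μ v
    simp only [inv_one, TensorProduct.AlgebraTensorModule.curry_apply,
      LinearMap.compMultilinearMap_apply, LinearMap.restrictScalars_self,
      TensorProduct.curry_apply, TensorProduct.map_tmul, P.perm_one, LinearEquiv.coe_coe,
      PiTensorProduct.reindex_tprod]
    rfl
  map_mul' σ τ := by
    ext μ v
    simp only [mul_inv_rev, TensorProduct.AlgebraTensorModule.curry_apply,
      LinearMap.compMultilinearMap_apply, LinearMap.restrictScalars_self, Module.End.mul_apply,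
      TensorProduct.curry_apply, TensorProduct.map_tmul, P.perm_mul, LinearEquiv.coe_coe,
      PiTensorProduct.reindex_tprod]
    rfl

/-- `S(P, V)`, the direct sum of the modules of coinvariants of `P(n) ⊗ V^{⊗ n}`. -/
abbrev S : Type u := DirectSum ℕ fun n => (diag P V n).Coinvariants

variable {V}

namespace S

/-- The class `(μ; v₁, …, vₙ)` in `S(P, V)`. -/
noncomputable def mk {n : ℕ} : P.obj n →ₗ[R] MultilinearMap R (fun _ : Fin n => V) (S P V) where
  toFun μ := ((DirectSum.lof R ℕ (fun n => (diag P V n).Coinvariants) n ∘ₗ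
    Representation.Coinvariants.mk (diag P V n)) ∘ₗ
      TensorProduct.mk R _ _ μ).compMultilinearMap (PiTensorProduct.tprod R)
  map_add' μ ν := MultilinearMap.ext fun v => by simp
  map_smul' r μ := MultilinearMap.ext fun v => by simp

theorem mk_apply {n : ℕ} (μ : P.obj n) (v : Fin n → V) :
    mk P μ v = DirectSum.lof R ℕ (fun n => (diag P V n).Coinvariants) n
      (Representation.Coinvariants.mk (diag P V n) (μ ⊗ₜ PiTensorProduct.tprod R v)) := rfl

theorem mk_perm {n : ℕ} (σ : Equiv.Perm (Fin n)) (μ : P.obj n) (v : Fin n → V) :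
    mk P (P.perm σ μ) v = mk P μ (fun i => v (σ⁻¹ i)) := by
  have h : (diag P V n) σ (P.perm σ μ ⊗ₜ PiTensorProduct.tprod R v) =
      μ ⊗ₜ PiTensorProduct.tprod R (fun i => v (σ⁻¹ i)) := by
    simp only [diag, MonoidHom.coe_mk, OneHom.coe_mk, TensorProduct.map_tmul,
      LinearEquiv.coe_coe, PiTensorProduct.reindex_tprod, ← P.perm_mul, mul_inv_cancel,
      P.perm_one]
    rfl
  rw [mk_apply, mk_apply, ← h, Representation.Coinvariants.mk_self_apply]

theorem mk_relabel {m n : ℕ} (e : Fin m ≃ Fin n) (μ : P.obj m) (v : Fin n → V) :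
    mk P (P.relabel e μ) v = mk P μ (fun i => v (e i)) := by
  obtain rfl : m = n := Fin.equiv_iff_eq.mp ⟨e⟩
  rw [SymmSeq.relabel_perm, mk_perm]
  simp

variable {P} {N : Type*} [AddCommGroup N] [Module R N]

/-- Linear maps out of `S(P, V)`. -/
noncomputable def lift (φ : ∀ n, P.obj n →ₗ[R] MultilinearMap R (fun _ : Fin n => V) N)
    (h : ∀ n (σ : Equiv.Perm (Fin n)) (μ : P.obj n) (v : Fin n → V),
      φ n (P.perm σ μ) v = φ n μ (fun i => v (σ⁻¹ i))) : S P V →ₗ[R] N :=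
  DirectSum.toModule R ℕ N fun n => Representation.Coinvariants.lift (diag P V n)
    (TensorProduct.lift ((PiTensorProduct.lift (R := R)).toLinearMap ∘ₗ φ n)) (by
      intro σ
      ext μ v
      have := h n σ (P.perm σ⁻¹ μ) v
      rw [← P.perm_mul, inv_mul_cancel, P.perm_one] at this
      simp [diag, this])

theorem lift_mk (φ : ∀ n, P.obj n →ₗ[R] MultilinearMap R (fun _ : Fin n => V) N)
    (h : ∀ n (σ : Equiv.Perm (Fin n)) (μ : P.obj n) (v : Fin n → V),
      φ n (P.perm σ μ) v = φ n μ (fun i => v (σ⁻¹ i))) {n : ℕ} (μ : P.obj n) (v : Fin n → V) :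
    lift φ h (mk P μ v) = φ n μ v := by
  simp [lift, mk_apply]

theorem hom_ext {f g : S P V →ₗ[R] N}
    (h : ∀ n (μ : P.obj n) (v : Fin n → V), f (mk P μ v) = g (mk P μ v)) : f = g := by
  refine DirectSum.linearMap_ext _ fun n => Representation.Coinvariants.hom_ext ?_
  ext μ v
  exact h n μ v

variable (P V) in
/-- Generators of `S(P, V)`. -/
abbrev Gen : Type u := Σ n, P.obj n × (Fin n → V)

variable (P V) in
/-- The presentation of `S(P, V)` by generators. -/
noncomputable def proj : (Gen P V →₀ R) →ₗ[R] S P V :=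
  Finsupp.linearCombination R fun g => mk P g.2.1 g.2.2

theorem proj_single (g : Gen P V) : proj P V (Finsupp.single g 1) = mk P g.2.1 g.2.2 := by
  simp [proj]

theorem proj_surjective : Function.Surjective (proj P V) := by
  rw [← LinearMap.range_eq_top]
  have : (LinearMap.range (proj P V)).mkQ = 0 := by
    apply hom_ext
    intro n μ v
    rw [LinearMap.zero_apply, Submodule.mkQ_apply, Submodule.Quotient.mk_eq_zero]
    exact ⟨Finsupp.single ⟨n, μ, v⟩ 1, proj_single _⟩
  rw [← Submodule.ker_mkQ (LinearMap.range (proj P V)), this, LinearMap.ker_zero]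

theorem multilinear_ext {ι : Type*} [Fintype ι] {f g : MultilinearMap R (fun _ : ι => S P V) N}
    (h : ∀ (n : ι → ℕ) (ν : ∀ i, P.obj (n i)) (v : ∀ i, Fin (n i) → V),
      f (fun i => mk P (ν i) (v i)) = g (fun i => mk P (ν i) (v i))) : f = g := by
  have h' : f.compLinearMap (fun _ => proj P V) = g.compLinearMap (fun _ => proj P V) := by
    refine Module.Basis.ext_multilinear (fun _ => Finsupp.basisSingleOne) fun x => ?_
    simp only [Finsupp.coe_basisSingleOne, MultilinearMap.compLinearMap_apply, proj_single]
    exact h (fun i => (x i).1) (fun i => (x i).2.1) (fun i => (x i).2.2)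
  refine MultilinearMap.ext fun s => ?_
  choose e he using fun i => proj_surjective (P := P) (V := V) (s i)
  have := congrArg (fun F => F e) h'
  simpa [he] using this

/-- The composite `(μ; (ν₁; v₁), …, (νₖ; vₖ)) ↦ (μ(ν₁, …, νₖ); v₁, …, vₖ)` on generators, as a
linear function of `μ`. -/
noncomputable def genOp {k : ℕ} (x : Fin k → Gen P V) : P.obj k →ₗ[R] S P V where
  toFun μ := mk P (P.comp (fun i => (x i).1) μ fun i => (x i).2.1)
    (flat (fun i => (x i).1) fun i => (x i).2.2)
  map_add' μ ν := by simp
  map_smul' r μ := by simp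

theorem genOp_mk {k : ℕ} (n : Fin k → ℕ) (ν : ∀ i, P.obj (n i)) (v : ∀ i, Fin (n i) → V)
    (μ : P.obj k) :
    genOp (fun i => ⟨n i, ν i, v i⟩) μ =
      mk P (P.comp n μ ν) (flat n v) := rfl

theorem update_gen {W : Type u} {k : ℕ} (x : Fin k → Gen P W) (i : Fin k) (ν : P.obj (x i).1)
    (v : Fin (x i).1 → W) :
    Function.update x i ⟨(x i).1, ν, v⟩ = fun j => ⟨(x j).1,
      Function.update (fun j => (x j).2.1) i ν j, Function.update (fun j => (x j).2.2) i v j⟩ := by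
  funext j
  by_cases hj : j = i
  · subst hj; simp
  · simp [hj]

theorem flat_update {W : Type u} {k : ℕ} (n : Fin k → ℕ) (v : ∀ i, Fin (n i) → W) (i : Fin k)
    (w : Fin (n i) → W) (j : Fin (n i)) (x : W) :
    flat n (Function.update v i (Function.update w j x)) =
    Function.update (flat n (Function.update v i w)) (pairs n ⟨i, j⟩) x := by
  funext t
  obtain ⟨⟨a, b⟩, rfl⟩ := (pairs n).surjective t
  rw [flat_pairs]
  by_cases ha : a = i
  · subst ha
    by_cases hb : b = j
    · subst hb; simp
    · have hne : pairs n ⟨a, b⟩ ≠ pairs n ⟨a, j⟩ := by simpa using hb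
      rw [Function.update_of_ne hne, flat_pairs]
      simp [hb]
  · have hne : pairs n ⟨a, b⟩ ≠ pairs n ⟨i, j⟩ := by simp [ha]
    rw [Function.update_of_ne hne, flat_pairs]
    simp [ha]

theorem genOp_slot {k : ℕ} (x : Fin k → Gen P V) (i : Fin k) (m : ℕ) :
    ∃ φ : P.obj m →ₗ[R] MultilinearMap R (fun _ : Fin m => V) (P.obj k →ₗ[R] S P V),
      ∀ ν v, φ ν v = genOp (Function.update x i ⟨m, ν, v⟩) := by
  obtain ⟨y, hy, hm⟩ : ∃ y : Fin k → Gen P V,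
      (∀ g, Function.update x i g = Function.update y i g) ∧ (y i).1 = m :=
    ⟨Function.update x i ⟨m, 0, 0⟩, by simp, by simp⟩
  subst hm
  have hy' : ∀ ν v, genOp (Function.update x i ⟨(y i).1, ν, v⟩) = genOp fun j => ⟨(y j).1,
      Function.update (fun j => (y j).2.1) i ν j, Function.update (fun j => (y j).2.2) i v j⟩ :=
    fun ν v => congrArg genOp ((hy _).trans (update_gen y i ν v))
  refine ⟨LinearMap.mk ⟨fun ν => MultilinearMap.mk' (fun v => genOp fun j => ⟨(y j).1,
      Function.update (fun j => (y j).2.1) i ν j,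
      Function.update (fun j => (y j).2.2) i v j⟩) ?_ ?_, ?_⟩ ?_, fun ν v => (hy' ν v).symm⟩
  · intro w j a b
    refine LinearMap.ext fun μ => ?_
    simp only [genOp_mk, LinearMap.add_apply, flat_update, MultilinearMap.map_update_add]
  · intro w j c a
    refine LinearMap.ext fun μ => ?_
    simp only [genOp_mk, LinearMap.smul_apply, flat_update, MultilinearMap.map_update_smul]
  · intro ν ν'
    refine MultilinearMap.ext fun v => LinearMap.ext fun μ => ?_
    simp only [MultilinearMap.mk'_apply, add_apply, genOp_mk, LinearMap.add_apply,
      MultilinearMap.map_update_add, map_add]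
  · intro c ν
    refine MultilinearMap.ext fun v => LinearMap.ext fun μ => ?_
    simp only [MultilinearMap.mk'_apply, smul_apply, genOp_mk, LinearMap.smul_apply,
      MultilinearMap.map_update_smul, map_smul, RingHom.id_apply]

theorem genOp_perm {k : ℕ} (x : Fin k → Gen P V) (i : Fin k) (m : ℕ) (σ : Equiv.Perm (Fin m))
    (ν : P.obj m) (v : Fin m → V) :
    genOp (Function.update x i ⟨m, P.perm σ ν, v⟩) =
      genOp (Function.update x i ⟨m, ν, fun j => v (σ⁻¹ j)⟩) := by
  obtain ⟨y, hy, hm⟩ : ∃ y : Fin k → Gen P V,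
      (∀ g, Function.update x i g = Function.update y i g) ∧ (y i).1 = m :=
    ⟨Function.update x i ⟨m, 0, 0⟩, by simp, by simp⟩
  subst hm
  have hy' : ∀ ν v, genOp (Function.update x i ⟨(y i).1, ν, v⟩) = genOp fun j => ⟨(y j).1,
      Function.update (fun j => (y j).2.1) i ν j, Function.update (fun j => (y j).2.2) i v j⟩ :=
    fun ν v => congrArg genOp ((hy _).trans (update_gen y i ν v))
  rw [hy', hy']
  ext1 μ
  simp only [genOp_mk]
  have h : Function.update (fun j => (y j).2.1) i (P.perm σ ν) = fun j =>
      P.perm (Function.update (fun j => (1 : Equiv.Perm (Fin (y j).1))) i σ j)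
        (Function.update (fun j => (y j).2.1) i ν j) := by
    funext j
    by_cases hj : j = i
    · subst hj; simp
    · simp [hj, P.perm_one]
  rw [h, P.comp_perm_right, mk_perm]
  congr 1
  funext t
  obtain ⟨⟨a, b⟩, rfl⟩ := (pairs fun j => (y j).1).surjective t
  have hb : (blockSum (fun j => (y j).1) (Function.update (fun j => 1) i σ))⁻¹
      (pairs (fun j => (y j).1) ⟨a, b⟩) = pairs (fun j => (y j).1)
        ⟨a, (Function.update (fun j => (1 : Equiv.Perm (Fin (y j).1))) i σ a)⁻¹ b⟩ := by
    rw [Equiv.Perm.inv_eq_iff_eq]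
    simp [blockSum, Equiv.permCongr_apply]
  rw [hb]
  rw [flat_pairs, flat_pairs]
  by_cases ha : a = i
  · subst ha; simp
  · simp [ha]

theorem extendMul_genOp_vanish {k : ℕ} (i : Fin k) (e : Fin k → (Gen P V →₀ R))
    (h : proj P V (e i) = 0) : extendMul (R := R) (genOp (P := P) (V := V)) e = 0 := by
  have key : (extendMul (R := R) (genOp (P := P) (V := V) (k := k))).domDomRestrict (· ≠ i)
      (fun _ => e i) = 0 := by
    refine Module.Basis.ext_multilinear (fun _ => Finsupp.basisSingleOne) fun x => ?_
    obtain ⟨x', hx'⟩ : ∃ x' : Fin k → Gen P V, ∀ j : {j // j ≠ i}, x' j = x j :=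
      ⟨fun j => if h : j ≠ i then x ⟨j, h⟩ else ⟨0, 0, 0⟩, fun j => by simp [j.2]⟩
    choose φ hφ using genOp_slot x' i
    have hF : (extendMul (R := R) (genOp (P := P) (V := V))).toLinearMap
        (fun j => Finsupp.single (x' j) 1) i = lift φ (fun n σ μ v => by
          rw [hφ, hφ, genOp_perm]) ∘ₗ proj P V := by
      refine Finsupp.lhom_ext' fun g => LinearMap.ext_ring ?_
      simp only [LinearMap.comp_apply, Finsupp.lsingle_apply, proj_single, lift_mk, hφ,
        MultilinearMap.toLinearMap_apply]
      rw [← extendMul_single (R := R) genOp]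
      congr 1
      funext j
      by_cases hj : j = i
      · subst hj; simp
      · simp [hj]
    have := congrArg (fun F => F (e i)) hF
    simp only [MultilinearMap.toLinearMap_apply, LinearMap.comp_apply, h, map_zero] at this
    rw [zero_apply, ← this, MultilinearMap.domDomRestrict_apply]
    congr 1
    funext j
    by_cases hj : j = i
    · subst hj; simp
    · simp [hj, hx' ⟨j, hj⟩]
  have := congrArg (fun F => F fun j => e j) key
  simp only [MultilinearMap.domDomRestrict_apply, zero_apply] at this
  rw [← this]
  congr 1
  funext j
  by_cases hj : j = i
  · subst hj; simp
  · simp [hj]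

variable (P V) in
/-- The operations of `S(P, V)`. -/
noncomputable def op {k : ℕ} :
    P.obj k →ₗ[R] MultilinearMap R (fun _ : Fin k => S P V) (S P V) where
  toFun μ := (LinearMap.applyₗ μ).compMultilinearMap
    (descend (proj P V) proj_surjective (extendMul genOp)
      fun i e h => extendMul_genOp_vanish i e h)
  map_add' μ ν := by ext1 s; simp
  map_smul' r μ := by ext1 s; simp

theorem op_mk {k : ℕ} (n : Fin k → ℕ) (μ : P.obj k) (ν : ∀ i, P.obj (n i))
    (v : ∀ i, Fin (n i) → V) :
    op P V μ (fun i => mk P (ν i) (v i)) =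
      mk P (P.comp n μ ν) (flat n v) := by
  have h : (fun i => mk P (ν i) (v i)) = fun i =>
      proj P V (Finsupp.single (⟨n i, ν i, v i⟩ : Gen P V) 1) := by
    simp [proj_single]
  rw [h, op, LinearMap.coe_mk, AddHom.coe_mk, LinearMap.compMultilinearMap_apply, descend_apply,
    extendMul_single, LinearMap.applyₗ_apply_apply, genOp_mk]

theorem op_perm {k : ℕ} (σ : Equiv.Perm (Fin k)) (μ : P.obj k) (a : Fin k → S P V) :
    op P V (P.perm σ μ) a = op P V μ (fun i => a (σ⁻¹ i)) := by
  have h : op P V (P.perm σ μ) = (op P V μ).domDomCongr σ⁻¹ := by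
    apply multilinear_ext
    intro n ν v
    rw [op_mk, P.comp_perm_left, mk_relabel, MultilinearMap.domDomCongr_apply,
      op_mk (fun i => n (σ⁻¹ i)) μ (fun i => ν (σ⁻¹ i)) (fun i => v (σ⁻¹ i))]
    congr 1
    funext t
    obtain ⟨⟨a, b⟩, rfl⟩ := (pairs _).surjective t
    have h' : blockPerm n σ (pairs (fun i => n (σ⁻¹ i)) ⟨a, b⟩) = pairs n ⟨σ⁻¹ a, b⟩ := by
      simp [blockPerm, Equiv.sigmaCongrLeft]
    rw [h', flat_pairs, flat_pairs]
  rw [h]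
  rfl

theorem op_one (a : Fin 1 → S P V) : op P V P.one a = a 0 := by
  have h : op P V P.one = MultilinearMap.ofSubsingleton R _ _ 0 LinearMap.id := by
    apply multilinear_ext
    intro n ν v
    rw [op_mk, P.one_comp, mk_relabel]
    simp only [MultilinearMap.ofSubsingleton_apply_apply, LinearMap.id_apply]
    congr 1
    funext t
    have h' : unitLeft n t = pairs n ⟨0, t⟩ := rfl
    rw [h', flat_pairs]
  rw [h]
  simp

theorem op_comp {k : ℕ} (n : Fin k → ℕ) (μ : P.obj k) (ν : ∀ i, P.obj (n i))
    (a : Fin (∑ i, n i) → S P V) :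
    op P V (P.comp n μ ν) a = op P V μ (fun i => op P V (ν i) fun j => a (pairs n ⟨i, j⟩)) := by
  have h : op P V (P.comp n μ ν) = compose n (op P V μ) fun i => op P V (ν i) := by
    apply multilinear_ext
    intro l ξ v
    rw [op_mk, P.comp_assoc, mk_relabel, compose_apply]
    simp only [op_mk (fun j => l (pairs n ⟨_, j⟩)) _ (fun j => ξ (pairs n ⟨_, j⟩))
      (fun j => v (pairs n ⟨_, j⟩))]
    rw [op_mk (fun i => ∑ j, l (pairs n ⟨i, j⟩)) μ
      (fun i => P.comp (fun j => l (pairs n ⟨i, j⟩)) (ν i) fun j => ξ (pairs n ⟨i, j⟩))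
      (fun i => flat (fun j => l (pairs n ⟨i, j⟩)) fun j => v (pairs n ⟨i, j⟩))]
    congr 1
    funext t
    obtain ⟨⟨a, b⟩, rfl⟩ := (pairs _).surjective t
    obtain ⟨⟨b, c⟩, rfl⟩ := (pairs _).surjective b
    have h' : assocEquiv n l (pairs (fun i => ∑ j, l (pairs n ⟨i, j⟩))
        ⟨a, pairs (fun j => l (pairs n ⟨a, j⟩)) ⟨b, c⟩⟩) = pairs l ⟨pairs n ⟨a, b⟩, c⟩ := by
      simp [assocEquiv, Equiv.sigmaCongrLeft, Equiv.sigmaAssoc]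
    rw [h', flat_pairs, flat_pairs, flat_pairs]
  rw [h, compose_apply]

end S

/-- `S(P, V)` as a `P`-algebra: the free `P`-algebra on `V`, with
`μ((ν₁; v₁), …, (νₖ; vₖ)) = (μ(ν₁, …, νₖ); v₁, …, vₖ)`. -/
noncomputable abbrev freePAlg (V : Type u) [AddCommGroup V] [Module R V] : PAlg P where
  carrier := S P V
  op := S.op P V
  op_perm σ μ a := S.op_perm σ μ a
  op_one a := S.op_one a
  op_comp n μ ν a := S.op_comp n μ ν a

end FreeAlgebra

/-! ### Ideals and quotients of algebras over an operad -/

namespace PAlg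

variable {P : Operad R}

/-- Ideals of a `P`-algebra: submodules `I` such that `μ(b₁, …, bₙ) ∈ I` as soon as one of the
`bₖ` is in `I`. -/
def IsIdeal (B : PAlg P) (I : Submodule R B) : Prop :=
  ∀ {n : ℕ} (μ : P.obj n) (b : Fin n → B) (k : Fin n), b k ∈ I → B.op μ b ∈ I

/-- The ideal generated by a set. -/
def idealSpan (B : PAlg P) (s : Set B) : Submodule R B :=
  sInf {I | B.IsIdeal I ∧ s ⊆ I}

theorem isIdeal_idealSpan (B : PAlg P) (s : Set B) : B.IsIdeal (B.idealSpan s) := by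
  intro n μ b k hb
  rw [idealSpan, Submodule.mem_sInf] at hb ⊢
  exact fun I hI => hI.1 μ b k (hb I hI)

theorem subset_idealSpan (B : PAlg P) (s : Set B) : s ⊆ B.idealSpan s := by
  intro x hx
  rw [SetLike.mem_coe, idealSpan, Submodule.mem_sInf]
  exact fun I hI => hI.2 hx

/-- The operations of the quotient by an ideal. -/
noncomputable def quotientOp (B : PAlg P) (I : Submodule R B) (hI : B.IsIdeal I) {n : ℕ}
    (μ : P.obj n) : MultilinearMap R (fun _ : Fin n => B ⧸ I) (B ⧸ I) :=
  descend I.mkQ I.mkQ_surjective (I.mkQ.compMultilinearMap (B.op μ)) fun k b h => by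
    simp only [Submodule.mkQ_apply, Submodule.Quotient.mk_eq_zero,
      LinearMap.compMultilinearMap_apply] at h ⊢
    exact hI μ b k h

theorem quotientOp_mk (B : PAlg P) (I : Submodule R B) (hI : B.IsIdeal I) {n : ℕ}
    (μ : P.obj n) (b : Fin n → B) :
    B.quotientOp I hI μ (fun i => I.mkQ (b i)) = I.mkQ (B.op μ b) := by
  exact descend_apply _ _ _ _ b

/-- The quotient of a `P`-algebra by an ideal, with `μ([b₁], …, [bₙ]) = [μ(b₁, …, bₙ)]`. -/
noncomputable abbrev quotient (B : PAlg P) (I : Submodule R B) (hI : B.IsIdeal I) : PAlg P where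
  carrier := B ⧸ I
  op :=
    { toFun := fun μ => B.quotientOp I hI μ
      map_add' := fun μ ν => MultilinearMap.ext fun s => by
        choose b hb using fun i => I.mkQ_surjective (s i)
        obtain rfl : (fun i => I.mkQ (b i)) = s := funext hb
        rw [add_apply, quotientOp_mk, quotientOp_mk, quotientOp_mk, map_add, add_apply, map_add]
      map_smul' := fun r μ => MultilinearMap.ext fun s => by
        choose b hb using fun i => I.mkQ_surjective (s i)
        obtain rfl : (fun i => I.mkQ (b i)) = s := funext hb
        rw [smul_apply, quotientOp_mk, quotientOp_mk, map_smul, smul_apply, map_smul]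
        rfl }
  op_perm σ μ s := by
    choose b hb using fun i => I.mkQ_surjective (s i)
    obtain rfl : (fun i => I.mkQ (b i)) = s := funext hb
    simp only [LinearMap.coe_mk, AddHom.coe_mk]
    rw [quotientOp_mk, quotientOp_mk B I hI μ fun i => b (σ⁻¹ i), B.op_perm]
  op_one s := by
    choose b hb using fun i => I.mkQ_surjective (s i)
    obtain rfl : (fun i => I.mkQ (b i)) = s := funext hb
    simp only [LinearMap.coe_mk, AddHom.coe_mk]
    rw [quotientOp_mk, B.op_one]
  op_comp n μ ν s := by
    choose b hb using fun i => I.mkQ_surjective (s i)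
    obtain rfl : (fun i => I.mkQ (b i)) = s := funext hb
    simp only [LinearMap.coe_mk, AddHom.coe_mk]
    rw [quotientOp_mk]
    simp only [fun i => quotientOp_mk B I hI (ν i) fun j => b (pairs n ⟨i, j⟩)]
    rw [quotientOp_mk, B.op_comp]

end PAlg

/-! ### The forgetful functor from `A`-algebras to `A`-modules -/

section Forget

variable {P : Operad R} {A : PAlg P}

/-- The structure morphism `A → B` of an `A`-algebra, that is, of an object of the category
`Under A` of `P`-algebras under `A`. -/
abbrev unitHom (B : Under A) : A →ₗ[R] B.right := B.hom.hom

/-- The evaluation maps `μ(a₁, …, aₙ, b) = μ(u(a₁), …, u(aₙ), b)` of an `A`-algebra `B`. -/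
noncomputable def forgetEv (B : Under A) {n : ℕ} :
    P.obj (n + 1) →ₗ[R] MultilinearMap R (fun _ : Fin n => A) (B.right →ₗ[R] B.right) where
  toFun μ := (B.right.op μ).curryRight.compLinearMap fun _ => unitHom B
  map_add' μ ν := by ext; simp
  map_smul' r μ := by ext; simp

theorem forgetEv_apply (B : Under A) {n : ℕ} (μ : P.obj (n + 1)) (a : Fin n → A) (b : B.right) :
    forgetEv B μ a b =
      B.right.op μ (Fin.snoc (α := fun _ => B.right) (fun i => unitHom B (a i)) b) := rfl

theorem evSlot_forgetEv (B : Under A) {n : ℕ} (k : Fin n) (μ : P.obj n) (a : Fin n → A)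
    (b : B.right) :
    evSlot (forgetEv B) k μ a b =
      B.right.op μ (Function.update (fun i => unitHom B (a i)) k b) := by
  cases n with
  | zero => exact k.elim0
  | succ n =>
    rw [evSlot, forgetEv_apply, B.right.op_perm]
    congr 1
    funext i
    obtain ⟨i, rfl⟩ := (toLast k).surjective i
    rw [show ∀ f : Equiv.Perm (Fin (n + 1)), f⁻¹ (f i) = i from fun f => f.symm_apply_apply i]
    induction i using Fin.lastCases with
    | last =>
      have h : toLast k (Fin.last n) = k := by simp [toLast]
      simp [h]
    | cast i =>
      have h : toLast k i.castSucc = k.succAbove i := by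
        rw [← Fin.succAbove_last_apply]
        simp [toLast, -Fin.succAbove_last]
      simp [h]

/-- An `A`-algebra as an `A`-module. -/
noncomputable abbrev forgetObj (B : Under A) : AMod A where
  carrier := B.right
  ev := forgetEv B
  ev_perm {n} σ μ a x := by
    rw [forgetEv_apply, forgetEv_apply, B.right.op_perm]
    congr 1
    funext i
    obtain ⟨i, rfl⟩ := (fixLast σ).surjective i
    rw [show ∀ f : Equiv.Perm (Fin (n + 1)), f⁻¹ (f i) = i from fun f => f.symm_apply_apply i]
    induction i using Fin.lastCases with
    | last =>
      have h : fixLast σ (Fin.last n) = Fin.last n := by simp [fixLast]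
      simp [h]
    | cast i =>
      have h : fixLast σ i.castSucc = (σ i).castSucc := by
        rw [← Fin.succAbove_last_apply, ← Fin.succAbove_last_apply]
        simp [fixLast, -Fin.succAbove_last]
      simp [h]
  ev_one a x := by
    rw [forgetEv_apply, B.right.op_one]
    exact Fin.snoc_last (α := fun _ => B.right) x _
  ev_comp n μ ν i j a x := by
    rw [evSlot_forgetEv, evSlot_forgetEv, evSlot_forgetEv, B.right.op_comp]
    congr 1
    funext i'
    by_cases hi : i' = i
    · subst hi
      rw [Function.update_self]
      congr 1
      funext j'
      by_cases hj : j' = j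
      · subst hj; simp
      · have hne : pairs n ⟨i', j'⟩ ≠ pairs n ⟨i', j⟩ := by simpa using hj
        rw [Function.update_of_ne hne, Function.update_of_ne hj]
    · rw [Function.update_of_ne hi, unitHom, B.hom.map_op]
      congr 1
      funext j'
      have hne : pairs n ⟨i', j'⟩ ≠ pairs n ⟨i, j⟩ := by simp [hi]
      rw [Function.update_of_ne hne]

variable (A) in
/-- The functor `U_A` from `A`-algebras to `A`-modules. -/
noncomputable def forget : Under A ⥤ AMod A where
  obj := forgetObj
  map {B C} f :=
    { hom := f.right.hom
      map_ev := fun {n} μ a x => by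
        have h (y : A) : f.right.hom (unitHom B y) = unitHom C y :=
          congrArg (fun g : A ⟶ C.right => g.hom y) (Under.w f)
        change f.right.hom (forgetEv B μ a x) = forgetEv C μ a (f.right.hom x)
        rw [forgetEv_apply, forgetEv_apply, f.right.map_op]
        congr 1
        funext i
        induction i using Fin.lastCases with
        | last => simp
        | cast i => simp [h] }
  map_id _ := rfl
  map_comp _ _ := rfl

end Forget

/-! ### The free `A`-algebra on an `A`-module -/

section Free

variable {P : Operad R} {A : PAlg P} (M : AMod A)

/-- The element `(a, x) = (1; (a, x))` of `S(P, A × M)`. -/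
noncomputable def gen : (A × M) →ₗ[R] freePAlg P (A × M) where
  toFun y := S.mk P P.one fun _ => y
  map_add' y z := by
    have h (w : A × M) : Function.update (0 : Fin 1 → A × M) 0 w = fun _ => w := by
      funext i
      rw [Subsingleton.elim i 0, Function.update_self]
    have := (S.mk P (V := A × M) P.one).map_update_add 0 0 y z
    rwa [h, h, h] at this
  map_smul' r y := by
    have h (w : A × M) : Function.update (0 : Fin 1 → A × M) 0 w = fun _ => w := by
      funext i
      rw [Subsingleton.elim i 0, Function.update_self]
    have := (S.mk P (V := A × M) P.one).map_update_smul 0 0 r y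
    rwa [h, h] at this

theorem op_gen {n : ℕ} (μ : P.obj n) (y : Fin n → A × M) :
    (freePAlg P (A × M)).op μ (fun i => gen M (y i)) = S.mk P μ y := by
  change S.op P (A × M) μ (fun i => S.mk P P.one fun _ => y i) = _
  rw [S.op_mk (fun _ => 1) μ (fun _ => P.one) (fun i _ => y i), P.comp_one, S.mk_relabel]
  congr 1
  funext i
  exact flat_pairs (fun _ => 1) (fun i _ => y i) i 0

/-- The relations
`(μ; (a₁, 0), …, (aₖ, x), …, (aₙ, 0)) = (μ(a₁, …, aₙ), μ(a₁, …, x, …, aₙ))` for `μ ∈ P(n)` and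
`1 ≤ k ≤ n`, together with their analogue `(μ; ) = (μ(), 0)` for `μ ∈ P(0)`. -/
inductive FreeRel : freePAlg P (A × M) → freePAlg P (A × M) → Prop
  | eval {n : ℕ} (k : Fin n) (μ : P.obj n) (a : Fin n → A) (x : M) :
      FreeRel (S.mk P μ fun i => (a i, if i = k then x else 0))
        (gen M (A.op μ a, M.evAt k μ a x))
  | nullary (μ : P.obj 0) (a : Fin 0 → A) :
      FreeRel (S.mk P μ fun i => (a i, 0)) (gen M (A.op μ a, 0))

/-- The ideal of `S(P, A × M)` generated by the relations. -/
noncomputable def freeIdeal : Submodule R (freePAlg P (A × M)) :=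
  (freePAlg P (A × M)).idealSpan {z | ∃ s t, FreeRel M s t ∧ z = s - t}

/-- The `P`-algebra `Free_A M`. -/
noncomputable abbrev freeQuot : PAlg P :=
  (freePAlg P (A × M)).quotient (freeIdeal M) (PAlg.isIdeal_idealSpan _ _)

/-- The class of `(a, x)` in `Free_A M`. -/
noncomputable def cls : (A × M) →ₗ[R] freeQuot M :=
  (freeIdeal M).mkQ ∘ₗ gen M

theorem mkQ_eq_of_rel {s t : freePAlg P (A × M)} (h : FreeRel M s t) :
    (freeIdeal M).mkQ s = (freeIdeal M).mkQ t := by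
  rw [Submodule.mkQ_apply, Submodule.mkQ_apply, Submodule.Quotient.eq]
  exact PAlg.subset_idealSpan _ _ ⟨s, t, h, rfl⟩

/-- The morphism `u_M : A → Free_A M`, `u_M(a) = (a, 0)`. -/
noncomputable def freeUnit : A ⟶ freeQuot M where
  hom := cls M ∘ₗ LinearMap.inl R A M
  map_op {n} μ a := by
    have h1 : (freeQuot M).op μ (fun i => (cls M ∘ₗ LinearMap.inl R A M) (a i)) =
        (freeIdeal M).mkQ (S.mk P μ fun i => (a i, 0)) := by
      rw [← op_gen]
      exact PAlg.quotientOp_mk _ _ (PAlg.isIdeal_idealSpan _ _) μ fun i => gen M (a i, 0)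
    rw [h1]
    cases n with
    | zero =>
      have h := mkQ_eq_of_rel M (FreeRel.nullary μ a)
      rw [h]
      rfl
    | succ n =>
      have h := mkQ_eq_of_rel M (FreeRel.eval 0 μ a 0)
      have h0 : M.evAt 0 μ a 0 = 0 := map_zero _
      simp only [ite_self, h0] at h
      rw [h]
      rfl

/-- The `A`-algebra `Free_A M`. -/
noncomputable abbrev freeObj : Under A := Under.mk (freeUnit M)

end Free

end OperadicAlgebra

namespace OperadicAlgebra

variable {R : Type u} [CommRing R] {P : Operad R}

/-! A linear map $V \to B$ extends to a morphism $\mathsf S(\mathcal P,V) \to B$ of $\mathcal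
P$-algebras (`freeLift`). For $V = A \times M$, a linear map that restricts to the structure
morphism $u$ on $A$ has the form $(a,x) \mapsto u(a) + f(x)$ with $f : M \to B$ linear. The
relations of $\mathsf{Free}_A(M)$ are what makes $f$ an $A$-linear morphism, in both directions.

If $f$ is $A$-linear, then $\mu(u(a_1),\dots,u(a_k)+f(x),\dots,u(a_n))$ splits by multilinearity
into $u(\mu(a_1,\dots,a_n))$ and $f(\mu(a_1,\dots,x,\dots,a_n))$, so the extension respects the
relations (`freeLift_eq_of_rel`) and descends to $\mathsf{Free}_A(M)$ (`freeDesc`). Conversely, the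
relations with $a_k = 0$ have first component $0$ on the right, and they say that $x \mapsto (0,x)$
is $A$-linear (`toForgetFree`); composing it with a morphism of $A$-algebras gives an $A$-linear
$f$.

The two constructions are mutually inverse because a morphism of $A$-algebras out of
$\mathsf{Free}_A(M)$ is prescribed on $(a,0) = u_M(a)$, hence is determined by its values on the
$(0,x)$ (`freeObj_hom_ext`). The same principle reduces functoriality, and naturality in $M$, to
checks on the $(0,x)$. -/

/-! ### Morphisms out of $\mathsf S(\mathcal P,V)$ and out of quotients by ideals. -/

/-- The multilinear maps `v ↦ μ(φ(v₁), …, φ(vₙ))`, as a linear function of `μ`. -/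
noncomputable def opAlong {V : Type u} [AddCommGroup V] [Module R V] {B : PAlg P}
    (φ : V →ₗ[R] B) (n : ℕ) : P.obj n →ₗ[R] MultilinearMap R (fun _ : Fin n => V) B where
  toFun μ := (B.op μ).compLinearMap fun _ => φ
  map_add' μ ν := by ext; simp
  map_smul' r μ := by ext; simp

/-- The linear map `S(P, V) → B`, `(μ; v₁, …, vₙ) ↦ μ(φ(v₁), …, φ(vₙ))`. -/
noncomputable def freeLiftLinear {V : Type u} [AddCommGroup V] [Module R V] {B : PAlg P}
    (φ : V →ₗ[R] B) : S P V →ₗ[R] B :=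
  S.lift (opAlong φ) fun _ σ μ v => B.op_perm σ μ fun i => φ (v i)

theorem freeLiftLinear_mk {V : Type u} [AddCommGroup V] [Module R V] {B : PAlg P}
    (φ : V →ₗ[R] B) {n : ℕ} (μ : P.obj n) (v : Fin n → V) :
    freeLiftLinear φ (S.mk P μ v) = B.op μ fun i => φ (v i) :=
  S.lift_mk (opAlong φ) _ μ v

/-- The morphism of `P`-algebras `S(P, V) → B` that extends a linear map `V → B`. -/
noncomputable def freeLift {V : Type u} [AddCommGroup V] [Module R V] {B : PAlg P}
    (φ : V →ₗ[R] B) : freePAlg P V ⟶ B where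
  hom := freeLiftLinear φ
  map_op {k} μ s := by
    -- Both sides are multilinear in `s`, so it suffices to compare them on classes `(ν; v)`. There
    -- the left side applies a composite operation, and the identity is the associativity of `B`.
    have h : (freeLiftLinear φ).compMultilinearMap (S.op P V μ) =
        (B.op μ).compLinearMap fun _ => freeLiftLinear φ := by
      apply S.multilinear_ext
      intro n ν v
      rw [LinearMap.compMultilinearMap_apply, S.op_mk, freeLiftLinear_mk,
        MultilinearMap.compLinearMap_apply, B.op_comp]
      simp only [freeLiftLinear_mk, flat_pairs]
    exact congrArg (fun F => F s) h

theorem freeLift_mk {V : Type u} [AddCommGroup V] [Module R V] {B : PAlg P}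
    (φ : V →ₗ[R] B) {n : ℕ} (μ : P.obj n) (v : Fin n → V) :
    (freeLift φ).hom (S.mk P μ v) = B.op μ fun i => φ (v i) :=
  freeLiftLinear_mk φ μ v

/-- The kernel of a morphism of `P`-algebras is an ideal. -/
theorem PAlg.isIdeal_ker {B C : PAlg P} (f : B ⟶ C) : B.IsIdeal (LinearMap.ker f.hom) := by
  intro n μ b k hb
  rw [LinearMap.mem_ker] at hb ⊢
  rw [f.map_op]
  exact (C.op μ).map_coord_zero k hb

/-- The factorization of a morphism of `P`-algebras through the quotient by an ideal. -/
noncomputable def PAlg.quotientLift {B C : PAlg P} {I : Submodule R B} (hI : B.IsIdeal I)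
    (f : B ⟶ C) (hf : I ≤ LinearMap.ker f.hom) : B.quotient I hI ⟶ C where
  hom := I.liftQ f.hom hf
  map_op {n} μ s := by
    choose b hb using fun i => I.mkQ_surjective (s i)
    obtain rfl : (fun i => I.mkQ (b i)) = s := funext hb
    change I.liftQ f.hom hf (B.quotientOp I hI μ fun i => I.mkQ (b i)) = _
    rw [PAlg.quotientOp_mk]
    exact f.map_op μ b

/-! ### Generators of $\mathsf{Free}_A(M)$ and uniqueness of morphisms. -/

variable {A : PAlg P}

/-- Every class `(μ; y)` comes from applying an operation to generators, so morphisms of $\mathcal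
P$-algebras out of $\mathsf{Free}_A(M)$ can be computed from their values on `cls M`. -/
theorem op_cls (M : AMod A) {n : ℕ} (μ : P.obj n) (y : Fin n → A × M) :
    (freeQuot M).op μ (fun i => cls M (y i)) = (freeIdeal M).mkQ (S.mk P μ y) := by
  rw [← op_gen]
  exact PAlg.quotientOp_mk _ _ (PAlg.isIdeal_idealSpan _ _) μ fun i => gen M (y i)

theorem unitHom_freeObj (M : AMod A) (a : A) : unitHom (freeObj M) a = cls M (a, 0) := rfl

theorem Under.hom_unitHom {B C : Under A} (f : B ⟶ C) (a : A) :
    f.right.hom (unitHom B a) = unitHom C a :=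
  congrArg (fun g : A ⟶ C.right => g.hom a) (CategoryTheory.Under.w f)

theorem Under.comp_right_hom {B C D : Under A} (f : B ⟶ C) (g : C ⟶ D) (b : B.right) :
    (f ≫ g).right.hom b = g.right.hom (f.right.hom b) := rfl

/-- Morphisms out of `Free_A M` are determined by their values on `M`. -/
theorem freeObj_hom_ext {M : AMod A} {B : Under A} {f g : freeObj M ⟶ B}
    (h : ∀ x : M, f.right.hom (cls M (0, x)) = g.right.hom (cls M (0, x))) : f = g := by
  have hcls (y : A × M) : f.right.hom (cls M y) = g.right.hom (cls M y) := by
    -- The summand `(y.1, 0)` is $u_M$ of an element of $A$, and its image is imposed by the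
    -- structure morphism of `B`. Only `(0, y.2)` needs the hypothesis.
    have hy : y = (y.1, 0) + (0, y.2) := by simp
    rw [hy, map_add, map_add, map_add, h, ← unitHom_freeObj, Under.hom_unitHom,
      Under.hom_unitHom]
  apply Under.UnderMorphism.ext
  apply PAlg.Hom.ext
  refine Submodule.linearMap_qext _ (S.hom_ext fun n μ v => ?_)
  change f.right.hom ((freeIdeal M).mkQ (S.mk P μ v)) = g.right.hom ((freeIdeal M).mkQ (S.mk P μ v))
  rw [← op_cls]
  refine (f.right.map_op μ _).trans (Eq.trans ?_ (g.right.map_op μ _).symm)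
  exact congrArg _ (funext fun i => hcls (v i))

/-! ### The unit of the adjunction. -/

/-- The `A`-linear morphism `M → U_A (Free_A M)`, `x ↦ (0, x)`. -/
noncomputable def toForgetFree (M : AMod A) : M ⟶ (forget A).obj (freeObj M) where
  hom := cls M ∘ₗ LinearMap.inr R A M
  map_ev {n} μ a x := by
    change cls M (0, M.ev μ a x) = forgetEv (freeObj M) μ a (cls M (0, x))
    -- The relation is used in the last place, with `0` as the element of $A$ there: the last
    -- generator is then `(0, x)`, and `μ` evaluated in $A$ vanishes, so no $A$-component remains on
    -- the right.
    have hrel := mkQ_eq_of_rel M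
      (FreeRel.eval (Fin.last n) μ (Fin.snoc (α := fun _ => (A : Type u)) a 0) x)
    have hop : A.op μ (Fin.snoc (α := fun _ => (A : Type u)) a 0) = 0 :=
      (A.op μ).map_coord_zero (Fin.last n) (by simp)
    have hev : M.evAt (Fin.last n) μ (Fin.snoc (α := fun _ => (A : Type u)) a 0) x =
        M.ev μ a x := by
      -- The cycle that moves the last place to itself is trivial, so `evAt` at the last place is
      -- `ev` itself.
      have h1 : toLast (Fin.last n) = 1 := Equiv.self_trans_symm _
      simp [AMod.evAt, evSlot, h1, P.perm_one]
    rw [hop, hev, ← op_cls] at hrel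
    rw [forgetEv_apply]
    refine hrel.symm.trans (congrArg _ (funext fun i => ?_))
    induction i using Fin.lastCases with
    | last => simp
    | cast i =>
      simp only [Fin.snoc_castSucc, Fin.castSucc_ne_last, if_false]
      exact unitHom_freeObj M (a i)

/-! ### Extension of an $A$-linear morphism $M \to \mathsf U_A(B)$ to $\mathsf{Free}_A(M)$. -/

/-- The linear map underlying an `A`-linear morphism `M → U_A B`. -/
abbrev forgetHom {M : AMod A} {B : Under A} (f : M ⟶ (forget A).obj B) : M →ₗ[R] B.right :=
  f.hom

/-- The linear map `A × M → B`, `(a, x) ↦ u(a) + f(x)`. -/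
noncomputable def genMap {M : AMod A} {B : Under A} (f : M ⟶ (forget A).obj B) :
    (A × M) →ₗ[R] B.right :=
  (unitHom B).coprod (forgetHom f)

theorem genMap_apply {M : AMod A} {B : Under A} (f : M ⟶ (forget A).obj B) (a : A) (x : M) :
    genMap f (a, x) = unitHom B a + forgetHom f x := rfl

theorem freeLift_gen {M : AMod A} {B : Under A} (f : M ⟶ (forget A).obj B) (y : A × M) :
    (freeLift (genMap f)).hom (gen M y) = genMap f y :=
  (freeLift_mk _ _ _).trans (B.right.op_one _)

/-- Evaluation in the `k`-th place is evaluation in the last place of a permuted operation, so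
compatibility in the last place implies it everywhere. -/
theorem AMod.Hom.map_evAt {M N : AMod A} (f : M ⟶ N) {n : ℕ} (k : Fin n) (μ : P.obj n)
    (a : Fin n → A) (x : M) : f.hom (M.evAt k μ a x) = N.evAt k μ a (f.hom x) := by
  cases n with
  | zero => exact k.elim0
  | succ n => exact f.map_ev _ _ _

/-- Only the `k`-th entry has a component in `M`, so expanding by multilinearity gives two terms.
The one with $u(a_k)$ is handled by $u$ being a morphism of $\mathcal P$-algebras, the one with
$f(x)$ by the $A$-linearity of `f`. The nullary relation needs only that $u$ preserves constants. -/
theorem freeLift_eq_of_rel {M : AMod A} {B : Under A} (f : M ⟶ (forget A).obj B)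
    {s t : freePAlg P (A × M)} (h : FreeRel M s t) :
    (freeLift (genMap f)).hom s = (freeLift (genMap f)).hom t := by
  cases h with
  | @eval n k μ a x =>
    -- The tuple is put in the form of an update at `k` by a sum, to which additivity in the `k`-th
    -- argument applies.
    have hupd : (fun i => genMap f (a i, if i = k then x else 0)) =
        Function.update (fun i => unitHom B (a i)) k (unitHom B (a k) + forgetHom f x) := by
      funext i
      by_cases hi : i = k
      · subst hi; simp [genMap_apply]
      · simp [genMap_apply, hi]
    rw [freeLift_mk, freeLift_gen, hupd, MultilinearMap.map_update_add, genMap_apply,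
      Function.update_eq_self]
    congr 1
    · exact (B.hom.map_op μ a).symm
    · exact ((AMod.Hom.map_evAt f k μ a x).trans (evSlot_forgetEv B k μ a (f.hom x))).symm
  | nullary μ a =>
    rw [freeLift_mk, freeLift_gen, genMap_apply, map_zero, add_zero]
    refine Eq.trans ?_ (B.hom.map_op μ a).symm
    congr 1
    funext i
    exact i.elim0

/-- The morphism of `A`-algebras `Free_A M → B` with `(a, x) ↦ u(a) + f(x)`. -/
noncomputable def freeDesc {M : AMod A} {B : Under A} (f : M ⟶ (forget A).obj B) :
    freeObj M ⟶ B :=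
  Under.homMk
    -- The kernel of the extension is an ideal containing all differences of related elements, so it
    -- contains the smallest such ideal.
    (PAlg.quotientLift (PAlg.isIdeal_idealSpan _ _) (freeLift (genMap f)) (sInf_le
      ⟨PAlg.isIdeal_ker _, by
        rintro _ ⟨s, t, h, rfl⟩
        rw [SetLike.mem_coe, LinearMap.mem_ker, map_sub, freeLift_eq_of_rel f h, sub_self]⟩))
    -- Compatibility with the structure morphisms: `(a, 0)` goes to $u(a) + f(0) = u(a)$.
    (by
      apply PAlg.Hom.ext
      ext a
      refine (freeLift_gen f (a, 0)).trans ?_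
      rw [genMap_apply, map_zero, add_zero])

theorem freeDesc_cls {M : AMod A} {B : Under A} (f : M ⟶ (forget A).obj B) (a : A) (x : M) :
    (freeDesc f).right.hom (cls M (a, x)) = unitHom B a + forgetHom f x :=
  freeLift_gen f (a, x)

theorem freeDesc_cls_zero {M : AMod A} {B : Under A} (f : M ⟶ (forget A).obj B) (x : M) :
    (freeDesc f).right.hom (cls M (0, x)) = forgetHom f x := by
  rw [freeDesc_cls, map_zero, zero_add]

/-! ### Functoriality and the adjunction. -/

/-- The morphism `Free_A f`, with `(a, x) ↦ (a, f(x))`. -/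
noncomputable def freeMap {M N : AMod A} (f : M ⟶ N) : freeObj M ⟶ freeObj N :=
  -- Naturality of the unit forces this choice: the transpose of $M \to N \to \mathsf
  -- U_A\mathsf{Free}_A(N)$.
  freeDesc (f ≫ toForgetFree N)

theorem freeMap_cls {M N : AMod A} (f : M ⟶ N) (a : A) (x : M) :
    (freeMap f).right.hom (cls M (a, x)) = cls N (a, f.hom x) := by
  refine (freeDesc_cls _ a x).trans ?_
  change cls N (a, 0) + cls N (0, f.hom x) = _
  rw [← map_add]
  simp

variable (A) in
/-- The functor `Free_A` from `A`-modules to `A`-algebras. -/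
noncomputable def free : AMod A ⥤ Under A where
  obj := freeObj
  map := freeMap
  map_id M := freeObj_hom_ext fun x => freeMap_cls (𝟙 M) 0 x
  map_comp {_ M N} f g := freeObj_hom_ext fun x => by
    refine (freeMap_cls (f ≫ g) 0 x).trans (Eq.symm ?_)
    refine (Under.comp_right_hom (freeMap f) (freeMap g) _).trans ?_
    rw [freeMap_cls, freeMap_cls]
    rfl

variable (A) in
/-- `Free_A` is left adjoint to `U_A`. -/
noncomputable def freeAdj : free A ⊣ forget A :=
  Adjunction.mkOfHomEquiv
    { homEquiv := fun M B =>
        { toFun := fun g => toForgetFree M ≫ (forget A).map g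
          invFun := freeDesc
          -- This is the uniqueness half of the universal property; `right_inv` is the statement
          -- that the extension restricts to `f` on `M`.
          left_inv := fun g => freeObj_hom_ext fun x => freeDesc_cls_zero _ x
          right_inv := fun f => AMod.Hom.ext (LinearMap.ext fun x => freeDesc_cls_zero f x) }
      homEquiv_naturality_left_symm := fun {L M B} f g => freeObj_hom_ext fun x => by
        refine (freeDesc_cls_zero (f ≫ g) x).trans (Eq.symm ?_)
        refine (Under.comp_right_hom (freeMap f) (freeDesc g) _).trans ?_
        rw [freeMap_cls, freeDesc_cls_zero]
        rfl
      homEquiv_naturality_right := fun _ _ => rfl }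

/-- The unit is the transpose of the identity of `freeObj M`, hence is given by `toForgetFree M`. -/
theorem freeAdj_unit_app (M : AMod A) (x : M) :
    ((freeAdj A).unit.app M).hom x = cls M (0, x) := by
  simp only [freeAdj, Adjunction.mkOfHomEquiv_unit_app]
  rfl

end OperadicAlgebra

theorem mainTheorem12 {R : Type u} [CommRing R] (P : OperadicAlgebra.Operad R)
    (A : OperadicAlgebra.PAlg P) :
    ∃ (freeMap : ∀ {M N : OperadicAlgebra.AMod A}, (M ⟶ N) →
        (OperadicAlgebra.freeObj M ⟶ OperadicAlgebra.freeObj N))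
      (map_id : ∀ M : OperadicAlgebra.AMod A, freeMap (𝟙 M) = 𝟙 (OperadicAlgebra.freeObj M))
      (map_comp : ∀ {L M N : OperadicAlgebra.AMod A} (f : L ⟶ M) (g : M ⟶ N),
        freeMap (f ≫ g) = freeMap f ≫ freeMap g),
      (∀ {M N : OperadicAlgebra.AMod A} (f : M ⟶ N) (a : A) (x : M),
        (freeMap f).right.hom (OperadicAlgebra.cls M (a, x)) =
          OperadicAlgebra.cls N (a, f.hom x)) ∧
      ∃ adj : ({ obj := OperadicAlgebra.freeObj
                 map := freeMap
                 map_id := map_id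
                 map_comp := map_comp } :
            OperadicAlgebra.AMod A ⥤ Under A) ⊣ OperadicAlgebra.forget A,
        ∀ (M : OperadicAlgebra.AMod A) (x : M),
          (adj.unit.app M).hom x = OperadicAlgebra.cls M (0, x) :=
  -- The functor assembled in the statement from these fields is `free A` by unfolding, so `freeAdj
  -- A` has the required type.
  ⟨OperadicAlgebra.freeMap, (OperadicAlgebra.free A).map_id, (OperadicAlgebra.free A).map_comp,
    OperadicAlgebra.freeMap_cls, OperadicAlgebra.freeAdj A, OperadicAlgebra.freeAdj_unit_app⟩
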